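/- Let $X$ be a finite-dimensional real Hilbert space. For a family of sets $(C_i)$ in $X$ and indices $i\to *$: the outer limit $\limsup C_i$ is the set of $w$ for which there are a sequence $i_k\to *$ and $w_k\in C_{i_k}$ with $w_k\to w$; the inner limit $\liminf C_i$ is the set of $w$ such that for every sequence $i_k\to *$ there are $w_k\to w$ with $w_k\in C_{i_k}$ for all large $k$; and $C_i$ converges to $L$ if both limits equal $L$. Below, "$x\to\bar x$ in $S$" means $x\to\bar x$ with $x\in S$ ($x=\bar x$ is allowed if $\bar x\in S$), and $t\searrow 0$ means $t\to0$ with $t>0$. For $\Omega\subset X$ and $x\in\Omega$ let $$T_\Omega(x)=\limsup_{t\searrow0}\tfrac{\Omega-x}{t},\qquad \check T_\Omega(x)=\liminf_{t\searrow0}\tfrac{\Omega-x}{t},$$ $$\widehat T_\Omega(x)=\liminf_{x'\to x\text{ in }\Omega,\;t\searrow0}\tfrac{\Omega-x'}{t},\qquad \widetilde T_\Omega(x)=\limsup_{x'\to x\text{ in }\Omega,\;t\searrow0}\tfrac{\Omega-x'}{t}$$ be the tangent, derivable, regular (Clarke) and paratingent cones. The set $\Omega$ is called *derivable* at $x$ if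 $\check T_\Omega(x)=T_\Omega(x)$; *smooth* at $x$ if it is derivable at $x$ and $T_\Omega(x)$ is a linear subspace; and *strictly smooth* at $x$ if $\widehat T_\Omega(x)=\widetilde T_\Omega(x)$. It is *locally closed around* $x$ if $\Omega\cap V$ is closed for some closed neighbourhood $V$ of $x$. It is a *Lipschitzian manifold around* $x$ if there are an open neighbourhood $O$ of $x$, a splitting $X=Y\times Z$ into finite-dimensional spaces, and a $C^1$-diffeomorphism $\Phi$ from $O$ onto an open set $U=U'\times U''\subset Y\times Z$ such that $\Phi(\Omega\cap O)=(\operatorname{gph} f)\cap U$ for some Lipschitz continuous function $f:U'\to U''$. **Theorem.** Let $\Omega\subset X$ and $\bar x\in\Omega$, and let $\Omega$ be locally closed around $\bar x$. Consider the properties - (a) $\Omega$ is strictly smooth at $\bar x$; - (b) $T_\Omega(x)$ converges to $T_\Omega(\bar x)$ as $x\to\bar x$ in $\Omega$. Then (a) implies (b). If, in addition, $\Omega$ is a Lipschitzian manifold around $\bar x$, then (b) also implies (a), and both are equivalent to each of the following: - (c) $T_\Omega(x)$ converges to $T_\Omega(\bar x)$ as $x\to\bar x$ in the set of points $x\in\Omega$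 at which $\Omega$ is derivable; - (d) $T_\Omega(x)$ converges to $T_\Omega(\bar x)$ as $x\to\bar x$ in the set of points $x\in\Omega$ at which $\Omega$ is smooth; - (e) $T_\Omega(x)$ converges (to some set) as $x\to\bar x$ in the set of points $x\in\Omega$ at which $\Omega$ is smooth. -/

import Mathlib

open Filter Topology Set
open scoped NNReal

namespace VarGeom

/-- Inner limit (Painlevé–Kuratowski `liminf`) of a family of sets `C i` along a filter `l` on the
index set: the `w` such that for every sequence of indices `i k → l` there are `v k → w` with
`v k ∈ C (i k)` for all large `k`. -/
def innerLimit {ι X : Type*} [TopologicalSpace X] (l : Filter ι) (C : ι → Set X) : Set X :=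
  {w | ∀ i : ℕ → ι, Tendsto i atTop l →
    ∃ v : ℕ → X, Tendsto v atTop (𝓝 w) ∧ ∀ᶠ k in atTop, v k ∈ C (i k)}

/-- Outer limit (Painlevé–Kuratowski `limsup`) of a family of sets `C i` along a filter `l`: the
`w` for which there are a sequence of indices `i k → l` and `v k → w` with `v k ∈ C (i k)`. -/
def outerLimit {ι X : Type*} [TopologicalSpace X] (l : Filter ι) (C : ι → Set X) : Set X :=
  {w | ∃ i : ℕ → ι, Tendsto i atTop l ∧
    ∃ v : ℕ → X, Tendsto v atTop (𝓝 w) ∧ ∀ k, v k ∈ C (i k)}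

/-- Set convergence `C i → L` along `l`: inner and outer limits both equal `L`. -/
def SetTendsto {ι X : Type*} [TopologicalSpace X] (l : Filter ι) (C : ι → Set X) (L : Set X) :
    Prop :=
  innerLimit l C = L ∧ outerLimit l C = L

section Cones

variable {X : Type*} [NormedAddCommGroup X] [NormedSpace ℝ X]

/-- The set `(Ω - x) / t` of difference quotients. -/
def quotientSet (Ω : Set X) (x : X) (t : ℝ) : Set X :=
  (fun y => t⁻¹ • (y - x)) '' Ω

theorem mem_quotientSet {Ω : Set X} {x w : X} {t : ℝ} (ht : 0 < t) :
    w ∈ quotientSet Ω x t ↔ x + t • w ∈ Ω := by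
  constructor
  · rintro ⟨y, hy, rfl⟩
    simpa [smul_smul, mul_inv_cancel₀ ht.ne'] using hy
  · intro h
    exact ⟨_, h, by simp [smul_smul, inv_mul_cancel₀ ht.ne']⟩

/-- The (Bouligand) tangent cone. -/
def tangentCone (Ω : Set X) (x : X) : Set X :=
  outerLimit (𝓝[>] (0 : ℝ)) (fun t => quotientSet Ω x t)

/-- The derivable (adjacent) cone. -/
def derivableCone (Ω : Set X) (x : X) : Set X :=
  innerLimit (𝓝[>] (0 : ℝ)) (fun t => quotientSet Ω x t)

/-- The regular (Clarke) tangent cone: the inner limit of `(Ω - x') / t` as `x' → x` within `Ω`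
and `t ↘ 0`. -/
def clarkeCone (Ω : Set X) (x : X) : Set X :=
  innerLimit (𝓝[Ω] x ×ˢ 𝓝[>] (0 : ℝ)) (fun p => quotientSet Ω p.1 p.2)

/-- The paratingent cone: the outer limit of `(Ω - x') / t` as `x' → x` within `Ω` and
`t ↘ 0`. -/
def paratingentCone (Ω : Set X) (x : X) : Set X :=
  outerLimit (𝓝[Ω] x ×ˢ 𝓝[>] (0 : ℝ)) (fun p => quotientSet Ω p.1 p.2)

/-- The derivable cone and the tangent cone agree at `x`. -/
def DerivableAt (Ω : Set X) (x : X) : Prop :=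
  derivableCone Ω x = tangentCone Ω x

/-- `Ω` is smooth at `x`: it is derivable there and its tangent cone is a linear subspace. -/
def SmoothSetAt (Ω : Set X) (x : X) : Prop :=
  derivableCone Ω x = tangentCone Ω x ∧ ∃ V : Submodule ℝ X, tangentCone Ω x = (V : Set X)

/-- `Ω` is strictly smooth at `x`. -/
def StrictlySmoothSetAt (Ω : Set X) (x : X) : Prop :=
  clarkeCone Ω x = paratingentCone Ω x

/-- `Ω` is locally closed around `x`: its intersection with some closed neighbourhood of `x` is
closed. -/
def LocallyClosedAround (Ω : Set X) (x : X) : Prop :=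
  ∃ V ∈ 𝓝 x, IsClosed V ∧ IsClosed (Ω ∩ V)

/-- `Ω` is a Lipschitzian manifold around `x`: for some splitting of `X` as the product of two
complementary linear subspaces `Y` and `Z` there is a `C¹` diffeomorphism `Φ` from an open
neighbourhood of `x` (its source) onto an open box `U' ×ˢ U''` of `Y × Z` (its target), taking the
part of `Ω` in the source to the graph of a Lipschitz continuous function `f : U' → U''`. -/
def LipschitzManifoldAround (Ω : Set X) (x : X) : Prop :=
  ∃ Y Z : Submodule ℝ X, IsCompl Y Z ∧
    ∃ (Φ : OpenPartialHomeomorph X (Y × Z)) (U' : Set Y) (U'' : Set Z) (f : Y → Z) (K : ℝ≥0),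
      x ∈ Φ.source ∧
      ContDiffOn ℝ 1 Φ Φ.source ∧ ContDiffOn ℝ 1 Φ.symm Φ.target ∧
      IsOpen U' ∧ IsOpen U'' ∧ Φ.target = U' ×ˢ U'' ∧
      MapsTo f U' U'' ∧ LipschitzOnWith K f U' ∧
      Φ '' (Ω ∩ Φ.source) = {p : Y × Z | p.1 ∈ U' ∧ p.2 = f p.1}

end Cones

end VarGeom

/-! (a) ⇒ (b): for any set, the Clarke cone lies in the inner limit of the nearby tangent cones (by
compactness), this inner limit lies in `tangentCone Ω x`, and both that cone and the outer limit of
the nearby tangent cones lie in the paratingent cone. When the two extreme cones agree, all of these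
coincide.

On a Lipschitzian manifold, (b) ⇒ (c) ⇒ (d) only shrinks the set of base points. By Rademacher's
theorem smooth points accumulate at the reference point, so limits along them are not vacuous.

The real content is (e) ⇒ (a). Over a point where `f` is differentiable, the tangent cone is the
preimage of the graph of `fderiv ℝ f` under the derivative of the chart (`cones_eq_graphPreimage`).
These derivatives are bounded by the Lipschitz constant, hence have cluster points, and every
cluster point has the limit cone `L` as preimage of its graph (`eq_graphPreimage_of_tendsto`). A
linear map is determined by its graph, so the derivatives converge. For a Lipschitz function this
gives strict differentiability (`hasStrictFDerivAt_of_tendsto_fderiv`, a mean value inequality along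
almost every segment), which the chart turns into strict smoothness. -/

namespace VarGeom

/-! ### Lipschitz functions: from convergence of derivatives to strict differentiability. -/

section LipschitzAnalysis

open MeasureTheory

/-- A Lipschitz curve on `[0, 1]` whose derivative is a.e. bounded by `C` moves by at most `C`. -/
theorem norm_sub_le_of_lipschitzOn_of_ae_deriv_le {F : Type*} [NormedAddCommGroup F]
    [NormedSpace ℝ F] {φ : ℝ → F} {K : ℝ≥0} {C : ℝ} (hφ : LipschitzOnWith K φ (Icc 0 1))
    (h : ∀ᵐ t : ℝ, t ∈ Icc (0 : ℝ) 1 → ∃ d, HasDerivAt φ d t ∧ ‖d‖ ≤ C) :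
    ‖φ 1 - φ 0‖ ≤ C := by
  -- A functional of norm at most 1 that attains the norm of the increment reduces the claim to a
  -- real-valued curve, whose increment is the integral of its derivative.
  obtain ⟨ℓ, hℓ, hℓφ⟩ := exists_dual_vector'' ℝ (φ 1 - φ 0)
  have hlip : LipschitzOnWith (‖ℓ‖₊ * K) (fun t => ℓ (φ t)) (uIcc 0 1) := by
    rw [uIcc_of_le zero_le_one]
    exact ℓ.lipschitz.comp_lipschitzOnWith hφ
  have hftc := hlip.absolutelyContinuousOnInterval.integral_deriv_eq_sub
  have hbound : ‖∫ t in (0 : ℝ)..1, deriv (fun t => ℓ (φ t)) t‖ ≤ C * |(1 : ℝ) - 0| := by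
    refine intervalIntegral.norm_integral_le_of_norm_le_const_ae ?_
    filter_upwards [h] with t ht htm
    rw [uIoc_of_le zero_le_one] at htm
    obtain ⟨d, hd, hdC⟩ := ht ⟨htm.1.le, htm.2⟩
    have hℓd : HasDerivAt (fun t => ℓ (φ t)) (ℓ d) t := ℓ.hasFDerivAt.comp_hasDerivAt t hd
    rw [hℓd.deriv]
    calc ‖ℓ d‖ ≤ ‖ℓ‖ * ‖d‖ := ℓ.le_opNorm d
      _ ≤ 1 * ‖d‖ := by gcongr
      _ ≤ C := by simpa using hdC
  rw [hftc, ← map_sub, hℓφ] at hbound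
  simpa using hbound

variable {E F : Type*} [NormedAddCommGroup E] [NormedSpace ℝ E] [FiniteDimensional ℝ E]
  [NormedAddCommGroup F] [NormedSpace ℝ F] [FiniteDimensional ℝ F]

/-- Points of differentiability of a Lipschitz function on an open set are dense there. -/
theorem neBot_nhdsWithin_differentiableAt {f : E → F} {K : ℝ≥0} {U : Set E} (hU : IsOpen U)
    (hf : LipschitzOnWith K f U) {a : E} (ha : a ∈ U) :
    (𝓝[{u | u ∈ U ∧ DifferentiableAt ℝ f u}] a).NeBot := by
  borelize E
  have hae := hf.ae_differentiableWithinAt_of_mem (μ := Measure.addHaar)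
  have hd := Measure.dense_of_ae hae
  have := mem_closure_iff_nhdsWithin_neBot.1 (hd.open_subset_closure_inter hU ha)
  refine this.mono (nhdsWithin_mono _ ?_)
  rintro u ⟨hu, hud⟩
  exact ⟨hu, (hud hu).differentiableAt (hU.mem_nhds hu)⟩

/-- Mean value inequality for Lipschitz functions: it suffices to bound the derivative where it
exists. -/
theorem norm_sub_le_of_lipschitzOn_of_fderiv_le {g : E → F} {K : ℝ≥0} {U : Set E}
    (hU : IsOpen U) (hconv : Convex ℝ U) (hg : LipschitzOnWith K g U) {C : ℝ}
    (hC : ∀ u ∈ U, DifferentiableAt ℝ g u → ‖fderiv ℝ g u‖ ≤ C) {a b : E} (ha : a ∈ U)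
    (hb : b ∈ U) : ‖g b - g a‖ ≤ C * ‖b - a‖ := by
  borelize E
  set v := b - a with hv
  -- Adding the complement of `U` gives `s` full measure in the whole space.
  set s : Set E := Uᶜ ∪ {u | DifferentiableAt ℝ g u} with hs
  have hsm : MeasurableSet s := hU.measurableSet.compl.union (measurableSet_of_differentiableAt ℝ g)
  have hsae : ∀ᵐ y ∂(Measure.addHaar : Measure E), y ∈ s := by
    filter_upwards [hg.ae_differentiableWithinAt_of_mem (μ := Measure.addHaar)] with y hy
    by_cases hyU : y ∈ U
    · exact Or.inr ((hy hyU).differentiableAt (hU.mem_nhds hyU))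
    · exact Or.inl hyU
  -- Fubini: for almost every `p`, the line through `p` in direction `v` meets `s` at almost every
  -- parameter. The segment from `a` itself may be exceptional, so the bound is proved for a dense
  -- set of translates and passed to `a` by continuity.
  have hline := (ae_ae_add_linearMap_mem_iff (LinearMap.toSpanSingleton ℝ E v)
    (volume : Measure ℝ) (Measure.addHaar : Measure E) hsm).2 hsae
  have hdense := Measure.dense_of_ae hline
  have hshift : Continuous fun p : E => p + v := by fun_prop
  set W : Set E := U ∩ (fun p => p + v) ⁻¹' U with hW
  have hWo : IsOpen W := hU.inter (hU.preimage hshift)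
  have haW : a ∈ W := ⟨ha, by simpa [hv] using hb⟩
  have hne := mem_closure_iff_nhdsWithin_neBot.1 (hdense.open_subset_closure_inter hWo haW)
  have hcont : ContinuousAt (fun p => ‖g (p + v) - g p‖) a := by
    refine (ContinuousAt.sub ?_ ?_).norm
    · exact ContinuousAt.comp (f := fun p => p + v)
        (hg.continuousOn.continuousAt (hU.mem_nhds haW.2)) hshift.continuousAt
    · exact hg.continuousOn.continuousAt (hU.mem_nhds ha)
  have hlim := hcont.tendsto.mono_left
    (nhdsWithin_le_nhds (s := W ∩ {p | ∀ᵐ t : ℝ, p + LinearMap.toSpanSingleton ℝ E v t ∈ s}))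
  have hgoal := le_of_tendsto (b := C * ‖v‖) hlim ?_
  · simpa [hv] using hgoal
  filter_upwards [self_mem_nhdsWithin] with p hp
  obtain ⟨⟨hpU, hpvU⟩, hpt⟩ := hp
  have hseg : ∀ t ∈ Icc (0 : ℝ) 1, p + t • v ∈ U := fun t ht => by
    have := hconv.add_smul_sub_mem hpU hpvU ht
    simpa using this
  have hdist : LipschitzWith ‖v‖₊ (fun t : ℝ => p + t • v) := by
    refine LipschitzWith.of_dist_le_mul fun x y => ?_
    rw [dist_add_left, dist_eq_norm, ← sub_smul, norm_smul, mul_comm]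
    rfl
  have hφ : LipschitzOnWith (K * ‖v‖₊) (fun t : ℝ => g (p + t • v)) (Icc 0 1) :=
    hg.comp hdist.lipschitzOnWith hseg
  have := norm_sub_le_of_lipschitzOn_of_ae_deriv_le (C := C * ‖v‖) hφ ?_
  · simpa using this
  filter_upwards [hpt] with t ht htm
  have htU := hseg t htm
  have hd : DifferentiableAt ℝ g (p + t • v) := by
    rcases ht with ht | ht
    · exact absurd htU ht
    · exact ht
  have hcurve : HasDerivAt (fun t : ℝ => p + t • v) v t := by
    simpa using ((hasDerivAt_id t).smul_const v).const_add p
  refine ⟨_, hd.hasFDerivAt.comp_hasDerivAt t hcurve, ?_⟩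
  exact (ContinuousLinearMap.le_opNorm _ _).trans (by gcongr; exact hC _ htU hd)

/-- A Lipschitz function whose derivative, where it exists, converges at `a` is strictly
differentiable at `a`. -/
theorem hasStrictFDerivAt_of_tendsto_fderiv {f : E → F} {K : ℝ≥0} {U : Set E} (hU : IsOpen U)
    (hf : LipschitzOnWith K f U) {a : E} (ha : a ∈ U) {A : E →L[ℝ] F}
    (h : Tendsto (fderiv ℝ f) (𝓝[{u | u ∈ U ∧ DifferentiableAt ℝ f u}] a) (𝓝 A)) :
    HasStrictFDerivAt f A a := by
  refine .of_isLittleO (Asymptotics.isLittleO_iff.2 fun ε hε => ?_)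
  have hev := h.eventually (Metric.closedBall_mem_nhds A hε)
  rw [eventually_nhdsWithin_iff] at hev
  obtain ⟨δ, hδ, hball⟩ := Metric.eventually_nhds_iff_ball.1 (hev.and (hU.eventually_mem ha))
  -- Strict differentiability says that `f - A` is `ε`-Lipschitz near `a`. The mean value inequality
  -- reduces this to a derivative bound at differentiability points.
  have hlip : LipschitzOnWith (K + ‖A‖₊) (fun u => f u - A u) (Metric.ball a δ) :=
    (hf.mono fun u hu => (hball u hu).2).sub A.lipschitz.lipschitzOnWith
  have key : ∀ u ∈ Metric.ball a δ, DifferentiableAt ℝ (fun u => f u - A u) u →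
      ‖fderiv ℝ (fun u => f u - A u) u‖ ≤ ε := fun u hu hd => by
    have hfd : DifferentiableAt ℝ f u := by
      simpa using hd.add A.differentiableAt
    have hfd' : HasFDerivAt (fun u => f u - A u) (fderiv ℝ f u - A) u :=
      hfd.hasFDerivAt.sub A.hasFDerivAt
    rw [hfd'.fderiv, ← dist_eq_norm]
    exact (hball u hu).1 ⟨(hball u hu).2, hfd⟩
  rw [nhds_prod_eq]
  filter_upwards [prod_mem_prod (Metric.ball_mem_nhds a hδ) (Metric.ball_mem_nhds a hδ)]
    with p hp
  have := norm_sub_le_of_lipschitzOn_of_fderiv_le Metric.isOpen_ball (convex_ball a δ) hlip key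
    hp.2 hp.1
  rwa [map_sub, sub_sub_sub_comm]

end LipschitzAnalysis

/-! ### Painlevé–Kuratowski limits in metric spaces. -/

section SetLimits

theorem mem_outerLimit_of_eventually {ι X : Type*} [TopologicalSpace X] {l : Filter ι}
    {C : ι → Set X} {w : X} {i : ℕ → ι} {v : ℕ → X} (hi : Tendsto i atTop l)
    (hv : Tendsto v atTop (𝓝 w)) (h : ∀ᶠ k in atTop, v k ∈ C (i k)) : w ∈ outerLimit l C := by
  obtain ⟨N, hN⟩ := eventually_atTop.1 h
  exact ⟨fun k => i (k + N), hi.comp (tendsto_add_atTop_nat N), fun k => v (k + N),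
    hv.comp (tendsto_add_atTop_nat N), fun k => hN _ (Nat.le_add_left N k)⟩

theorem innerLimit_subset_outerLimit {ι X : Type*} [TopologicalSpace X] {l : Filter ι} [l.NeBot]
    [l.IsCountablyGenerated] {C : ι → Set X} : innerLimit l C ⊆ outerLimit l C := by
  intro w hw
  obtain ⟨i, hi⟩ := exists_seq_tendsto l
  obtain ⟨v, hv, hvC⟩ := hw i hi
  exact mem_outerLimit_of_eventually hi hv hvC

/-- A finer filter enlarges the inner limit and shrinks the outer one. Nontriviality of `l` keeps
the inner limit inside the outer one, which pins both. -/
theorem SetTendsto.mono {ι X : Type*} [TopologicalSpace X] {l l' : Filter ι} [l.NeBot]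
    [l.IsCountablyGenerated] {C : ι → Set X} {L : Set X} (h : SetTendsto l' C L) (hl : l ≤ l') :
    SetTendsto l C L := by
  have hin : L ⊆ innerLimit l C := h.1 ▸ fun w hw i hi => hw i (hi.mono_right hl)
  have hout : outerLimit l C ⊆ L := by
    rw [← h.2]
    rintro w ⟨i, hi, hv⟩
    exact ⟨i, hi.mono_right hl, hv⟩
  have hio := innerLimit_subset_outerLimit (l := l) (C := C)
  exact ⟨(hio.trans hout).antisymm hin, hout.antisymm (hin.trans hio)⟩

variable {ι X : Type*} [PseudoMetricSpace X] {l : Filter ι} [l.IsCountablyGenerated]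
  {C : ι → Set X} {w : X}

theorem mem_innerLimit_iff :
    w ∈ innerLimit l C ↔ ∀ ε > 0, ∀ᶠ i in l, ∃ v ∈ C i, dist v w < ε := by
  classical
  constructor
  · intro hw ε hε
    by_contra hcon
    obtain ⟨i, hi, hiC⟩ := exists_seq_forall_of_frequently (not_eventually.1 hcon)
    obtain ⟨v, hv, hvC⟩ := hw i hi
    obtain ⟨k, hk, hkC⟩ := ((hv.eventually (Metric.ball_mem_nhds w hε)).and hvC).exists
    exact hiC k ⟨v k, hkC, hk⟩
  · intro h i hi
    -- The sets need not be closed, so nearest points may not exist: almost nearest ones, with error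
    -- `1 / (k + 1)`, suffice. The default `w` is used only where `C (i k)` is empty.
    have hnear : ∀ k, ∃ v, (C (i k)).Nonempty →
        v ∈ C (i k) ∧ dist v w < Metric.infDist w (C (i k)) + 1 / ((k : ℝ) + 1) := by
      intro k
      by_cases hne : (C (i k)).Nonempty
      · obtain ⟨v, hv, hd⟩ := (Metric.infDist_lt_iff hne).1
          (lt_add_of_pos_right (Metric.infDist w (C (i k))) (Nat.one_div_pos_of_nat (n := k)))
        exact ⟨v, fun _ => ⟨hv, by rwa [dist_comm]⟩⟩
      · exact ⟨w, fun hne' => absurd hne' hne⟩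
    choose v hv using hnear
    refine ⟨v, Metric.tendsto_nhds.2 fun ε hε => ?_, ?_⟩
    · filter_upwards [hi.eventually (h (ε / 2) (half_pos hε)),
        (tendsto_one_div_add_atTop_nhds_zero_nat (𝕜 := ℝ)).eventually
          (gt_mem_nhds (half_pos hε))] with k hk hk'
      obtain ⟨y, hy, hyd⟩ := hk
      have h1 := (hv k ⟨y, hy⟩).2
      have h2 := Metric.infDist_le_dist_of_mem (x := w) hy
      rw [dist_comm w y] at h2
      linarith
    · filter_upwards [hi.eventually (h 1 one_pos)] with k hk
      obtain ⟨y, hy, -⟩ := hk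
      exact (hv k ⟨y, hy⟩).1

theorem mem_outerLimit_iff :
    w ∈ outerLimit l C ↔ ∀ ε > 0, ∃ᶠ i in l, ∃ v ∈ C i, dist v w < ε := by
  constructor
  · rintro ⟨i, hi, v, hv, hvC⟩ ε hε
    refine hi.frequently (Eventually.frequently ?_)
    filter_upwards [hv.eventually (Metric.ball_mem_nhds w hε)] with k hk
    exact ⟨v k, hvC k, hk⟩
  · intro h
    obtain ⟨B, hB⟩ := l.exists_antitone_basis
    have hex : ∀ k : ℕ, ∃ i ∈ B k, ∃ v ∈ C i, dist v w < 1 / ((k : ℝ) + 1) := fun k => by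
      obtain ⟨i, hi, hiB⟩ :=
        ((h _ Nat.one_div_pos_of_nat).and_eventually (hB.mem k)).exists
      exact ⟨i, hiB, hi⟩
    choose i hiB v hv hvd using hex
    refine ⟨i, hB.tendsto hiB, v, ?_, hv⟩
    rw [tendsto_iff_dist_tendsto_zero]
    exact squeeze_zero (fun _ => dist_nonneg) (fun k => (hvd k).le)
      tendsto_one_div_add_atTop_nhds_zero_nat

/-- In a proper space, sets which frequently meet a closed ball have a cluster point in it. -/
theorem exists_mem_outerLimit_of_frequently [ProperSpace X] {r : ℝ}
    (h : ∃ᶠ i in l, ∃ v ∈ C i, dist v w ≤ r) : ∃ v ∈ outerLimit l C, dist v w ≤ r := by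
  obtain ⟨i, hi, hiC⟩ := exists_seq_forall_of_frequently h
  choose v hv hvd using hiC
  obtain ⟨a, ha, φ, hφ, hlim⟩ := (isCompact_closedBall w r).tendsto_subseq hvd
  exact ⟨a, ⟨i ∘ φ, hi.comp hφ.tendsto_atTop, v ∘ φ, hlim, fun k => hv _⟩, ha⟩

end SetLimits

/-! ### Inclusions between the cones of an arbitrary set. -/

section Cones

variable {X : Type*} [NormedAddCommGroup X] [NormedSpace ℝ X] {Ω : Set X} {x : X}

theorem derivableCone_eq_innerLimit_pure :
    derivableCone Ω x =
      innerLimit (pure x ×ˢ 𝓝[>] (0 : ℝ)) (fun p => quotientSet Ω p.1 p.2) := by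
  ext w
  rw [derivableCone, mem_innerLimit_iff, mem_innerLimit_iff]
  simp only [pure_prod, eventually_map]

theorem tangentCone_eq_outerLimit_pure :
    tangentCone Ω x =
      outerLimit (pure x ×ˢ 𝓝[>] (0 : ℝ)) (fun p => quotientSet Ω p.1 p.2) := by
  ext w
  rw [tangentCone, mem_outerLimit_iff, mem_outerLimit_iff]
  simp only [pure_prod, frequently_map]

/-- A diagonal argument: a vector tangent at `y` near `x` is approximated by difference quotients
based at `y`. In contrapositive form, currying the product filter supplies the iterated limit. -/
theorem outerLimit_tangentCone_subset_paratingentCone :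
    outerLimit (𝓝[Ω] x) (tangentCone Ω) ⊆ paratingentCone Ω x := by
  intro w hw
  rw [paratingentCone, mem_outerLimit_iff]
  intro ε hε hcon
  refine mem_outerLimit_iff.1 hw (ε / 2) (half_pos hε) (hcon.curry.mono ?_)
  rintro y hy ⟨v, hv, hvw⟩
  refine mem_outerLimit_iff.1 hv (ε / 2) (half_pos hε) (hy.mono ?_)
  rintro t ht ⟨v', hv', hvv'⟩
  exact ht ⟨v', hv', by linarith [dist_triangle v' v w]⟩

/-- For fixed `y` near `x`, difference quotients close to `w` exist for all small `t`. Compactness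
of a closed ball yields a limit of them, a vector tangent at `y` and close to `w`. -/
theorem clarkeCone_subset_innerLimit_tangentCone [FiniteDimensional ℝ X] :
    clarkeCone Ω x ⊆ innerLimit (𝓝[Ω] x) (tangentCone Ω) := by
  have := FiniteDimensional.proper ℝ X
  intro w hw
  rw [mem_innerLimit_iff]
  intro ε hε
  filter_upwards [(mem_innerLimit_iff.1 hw (ε / 2) (half_pos hε)).curry] with y hy
  obtain ⟨v, hv, hvw⟩ := exists_mem_outerLimit_of_frequently (r := ε / 2)
    (hy.mono fun t ⟨v, hv, hvw⟩ => ⟨v, hv, hvw.le⟩).frequently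
  exact ⟨v, hv, by linarith⟩

theorem tangentCone_subset_paratingentCone (hx : x ∈ Ω) :
    tangentCone Ω x ⊆ paratingentCone Ω x := by
  rw [tangentCone_eq_outerLimit_pure]
  rintro w ⟨i, hi, hv⟩
  exact ⟨i, hi.mono_right (prod_mono_left _ (pure_le_nhdsWithin hx)), hv⟩

/-- The base point `x` itself is admissible in `𝓝[Ω] x`; the tangent cone being closed does the
rest. -/
theorem innerLimit_tangentCone_subset (hx : x ∈ Ω) :
    innerLimit (𝓝[Ω] x) (tangentCone Ω) ⊆ tangentCone Ω x := by
  intro w hw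
  rw [tangentCone, mem_outerLimit_iff]
  intro ε hε
  obtain ⟨v, hv, hvw⟩ :=
    (mem_innerLimit_iff.1 hw (ε / 2) (half_pos hε)).self_of_nhdsWithin hx
  refine (mem_outerLimit_iff.1 hv (ε / 2) (half_pos hε)).mono ?_
  rintro t ⟨v', hv', hvv'⟩
  exact ⟨v', hv', by linarith [dist_triangle v' v w]⟩

/-- Tangent cones converge at points of strict smoothness. -/
theorem StrictlySmoothSetAt.setTendsto_tangentCone [FiniteDimensional ℝ X] (hx : x ∈ Ω)
    (h : StrictlySmoothSetAt Ω x) : SetTendsto (𝓝[Ω] x) (tangentCone Ω) (tangentCone Ω x) := by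
  have hne : (𝓝[Ω] x).NeBot := mem_closure_iff_nhdsWithin_neBot.1 (subset_closure hx)
  have hpara : paratingentCone Ω x ⊆ innerLimit (𝓝[Ω] x) (tangentCone Ω) :=
    Eq.trans_subset (Eq.symm h) clarkeCone_subset_innerLimit_tangentCone
  have hin : innerLimit (𝓝[Ω] x) (tangentCone Ω) = tangentCone Ω x :=
    (innerLimit_tangentCone_subset hx).antisymm
      ((tangentCone_subset_paratingentCone hx).trans hpara)
  refine ⟨hin, Subset.antisymm ?_ ?_⟩
  · exact hin ▸ outerLimit_tangentCone_subset_paratingentCone.trans hpara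
  · exact hin.symm.subset.trans innerLimit_subset_outerLimit

end Cones

/-! ### Cones and derivatives in a Lipschitz chart. -/

section Charts

/-- Difference quotients along a net of pairs converge to the value of the derivative. -/
theorem tendsto_smul_sub_of_hasFDerivAtFilter {ι E F : Type*} [NormedAddCommGroup E]
    [NormedSpace ℝ E] [NormedAddCommGroup F] [NormedSpace ℝ F] {f : E → F} {f' : E →L[ℝ] F}
    {L : Filter (E × E)} (hf : HasFDerivAtFilter f f' L) {l : Filter ι} {q p : ι → E} {t : ι → ℝ}
    {w : E} (hqp : Tendsto (fun i => (q i, p i)) l L)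
    (hw : Tendsto (fun i => t i • (q i - p i)) l (𝓝 w)) :
    Tendsto (fun i => t i • (f (q i) - f (p i))) l (𝓝 (f' w)) := by
  have h1 : (fun i => t i • (f (q i) - f (p i) - f' (q i - p i))) =o[l]
      fun i => t i • (q i - p i) :=
    (Asymptotics.isBigO_refl t l).smul_isLittleO (hf.isLittleO.comp_tendsto hqp)
  have h2 := (Asymptotics.isLittleO_one_iff ℝ).1 (h1.trans_isBigO (hw.isBigO_one ℝ))
  have h3 := h2.add ((f'.continuous.tendsto w).comp hw)
  rw [zero_add] at h3
  refine h3.congr fun i => ?_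
  simp [smul_sub]

theorem tendsto_fst_apply {X E F : Type*} [TopologicalSpace X] [TopologicalSpace E]
    [TopologicalSpace F] {Φ : OpenPartialHomeomorph X (E × F)} {x : X} (hxs : x ∈ Φ.source) :
    Tendsto (fun y => (Φ y).1) (𝓝 x) (𝓝 (Φ x).1) :=
  (continuous_fst.tendsto _).comp (Φ.continuousAt hxs)

variable {X E F : Type*} [NormedAddCommGroup X] [NormedSpace ℝ X]
  [NormedAddCommGroup E] [NormedSpace ℝ E] [NormedAddCommGroup F] [NormedSpace ℝ F]

theorem tendsto_clm_apply {ι E F : Type*} [NormedAddCommGroup E] [NormedSpace ℝ E]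
    [NormedAddCommGroup F] [NormedSpace ℝ F] {l : Filter ι} {T : ι → E →L[ℝ] F} {T' : E →L[ℝ] F}
    {v : ι → E} {w : E} (hT : Tendsto T l (𝓝 T')) (hv : Tendsto v l (𝓝 w)) :
    Tendsto (fun i => T i (v i)) l (𝓝 (T' w)) :=
  (isBoundedBilinearMap_apply.continuous.tendsto (T', w)).comp (hT.prodMk_nhds hv)

/-- The preimage of the graph of `A` under `T`. -/
def graphPreimage (T : X →L[ℝ] E × F) (A : E →L[ℝ] F) : Submodule ℝ X where
  carrier := {w | (T w).2 = A (T w).1}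
  add_mem' {v w} hv hw := by
    simp only [mem_ofPred_eq] at hv hw ⊢
    simp [hv, hw]
  zero_mem' := by simp
  smul_mem' c w hw := by
    simp only [mem_ofPred_eq] at hw ⊢
    simp [hw]

theorem mem_graphPreimage {T : X →L[ℝ] E × F} {A : E →L[ℝ] F} {w : X} :
    w ∈ graphPreimage T A ↔ (T w).2 = A (T w).1 := Iff.rfl

theorem graphPreimage_injective {T : X →L[ℝ] E × F} (hT : Function.Surjective T) :
    Function.Injective (graphPreimage T) := by
  intro A B hAB
  ext a
  obtain ⟨w, hw⟩ := hT (a, A a)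
  have hwB : w ∈ graphPreimage T B := hAB ▸ mem_graphPreimage.2 (by rw [hw])
  simpa [hw] using mem_graphPreimage.1 hwB

/-- `Φ` is a `C¹` diffeomorphism onto a box taking `Ω` to the graph of the Lipschitz function
`f`. -/
structure IsLipschitzChart (Ω : Set X) (Φ : OpenPartialHomeomorph X (E × F)) (U : Set E)
    (f : E → F) (K : ℝ≥0) : Prop where
  contDiffOn : ContDiffOn ℝ 1 Φ Φ.source
  contDiffOn_symm : ContDiffOn ℝ 1 Φ.symm Φ.target
  isOpen : IsOpen U
  mem_target : ∀ u ∈ U, (u, f u) ∈ Φ.target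
  lipschitzOnWith : LipschitzOnWith K f U
  image_eq : Φ '' (Ω ∩ Φ.source) = {p | p.1 ∈ U ∧ p.2 = f p.1}

namespace IsLipschitzChart

variable {Ω : Set X} {Φ : OpenPartialHomeomorph X (E × F)} {U : Set E} {f : E → F} {K : ℝ≥0}
  {x : X}

theorem apply_mem_graph (c : IsLipschitzChart Ω Φ U f K) (hx : x ∈ Ω) (hxs : x ∈ Φ.source) :
    (Φ x).1 ∈ U ∧ (Φ x).2 = f (Φ x).1 := by
  have : Φ x ∈ Φ '' (Ω ∩ Φ.source) := mem_image_of_mem _ ⟨hx, hxs⟩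
  rwa [c.image_eq] at this

theorem symm_apply_mem (c : IsLipschitzChart Ω Φ U f K) {u : E} (hu : u ∈ U) :
    Φ.symm (u, f u) ∈ Ω := by
  have : (u, f u) ∈ Φ '' (Ω ∩ Φ.source) := by
    rw [c.image_eq]
    exact ⟨hu, rfl⟩
  obtain ⟨y, ⟨hy, hys⟩, hyu⟩ := this
  rwa [← hyu, Φ.left_inv hys]

theorem hasStrictFDerivAt (c : IsLipschitzChart Ω Φ U f K) (hxs : x ∈ Φ.source) :
    HasStrictFDerivAt Φ (fderiv ℝ Φ x) x :=
  (c.contDiffOn.contDiffAt (Φ.open_source.mem_nhds hxs)).hasStrictFDerivAt one_ne_zero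

theorem hasStrictFDerivAt_symm (c : IsLipschitzChart Ω Φ U f K) {y : E × F}
    (hy : y ∈ Φ.target) : HasStrictFDerivAt Φ.symm (fderiv ℝ Φ.symm y) y :=
  (c.contDiffOn_symm.contDiffAt (Φ.open_target.mem_nhds hy)).hasStrictFDerivAt one_ne_zero

theorem fderiv_symm_fderiv (c : IsLipschitzChart Ω Φ U f K) (hxs : x ∈ Φ.source) (w : X) :
    fderiv ℝ Φ.symm (Φ x) (fderiv ℝ Φ x w) = w := by
  have h := (c.hasStrictFDerivAt_symm (Φ.map_source hxs)).hasFDerivAt.comp x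
    (c.hasStrictFDerivAt hxs).hasFDerivAt
  have h' : HasFDerivAt (Φ.symm ∘ Φ) (ContinuousLinearMap.id ℝ X) x :=
    (hasFDerivAt_id x).congr_of_eventuallyEq (Φ.eventually_left_inverse hxs)
  exact congrArg (fun T : X →L[ℝ] X => T w) (h.unique h')

theorem fderiv_fderiv_symm (c : IsLipschitzChart Ω Φ U f K) (hxs : x ∈ Φ.source) (y : E × F) :
    fderiv ℝ Φ x (fderiv ℝ Φ.symm (Φ x) y) = y := by
  have h1 := (c.hasStrictFDerivAt hxs).hasFDerivAt
  rw [← Φ.left_inv hxs] at h1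
  have h := h1.comp (Φ x) (c.hasStrictFDerivAt_symm (Φ.map_source hxs)).hasFDerivAt
  have h' : HasFDerivAt (Φ ∘ Φ.symm) (ContinuousLinearMap.id ℝ (E × F)) (Φ x) :=
    (hasFDerivAt_id _).congr_of_eventuallyEq (Φ.eventually_right_inverse (Φ.map_source hxs))
  have := congrArg (fun T : (E × F) →L[ℝ] (E × F) => T y) (h.unique h')
  simpa [Φ.left_inv hxs] using this

/-- The filter `G` of base points serves two cases at once: `𝓝[Ω] x` with a strict derivative of `f`
bounds the paratingent cone, `pure x` with a Fréchet derivative bounds the tangent cone. -/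
theorem outerLimit_quotientSet_subset (c : IsLipschitzChart Ω Φ U f K) (hxs : x ∈ Φ.source)
    {A : E →L[ℝ] F} {G : Filter X} (hG : G ≤ 𝓝[Ω] x)
    (hf : HasFDerivAtFilter f A (𝓝 (Φ x).1 ×ˢ map (fun y => (Φ y).1) G)) :
    outerLimit (G ×ˢ 𝓝[>] (0 : ℝ)) (fun p => quotientSet Ω p.1 p.2) ⊆
      graphPreimage (fderiv ℝ Φ x) A := by
  rintro w ⟨i, hi, v, hv, hvC⟩
  have hiG : Tendsto (fun k => (i k).1) atTop G := tendsto_fst.comp hi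
  have hiΩ := hiG.mono_right hG
  have hix := tendsto_nhds_of_tendsto_nhdsWithin hiΩ
  have hit : Tendsto (fun k => (i k).2) atTop (𝓝[>] 0) := tendsto_snd.comp hi
  have hq : Tendsto (fun k => (i k).1 + (i k).2 • v k) atTop (𝓝 x) := by
    simpa using hix.add ((tendsto_nhds_of_tendsto_nhdsWithin hit).smul hv)
  have hquot : Tendsto (fun k => (i k).2⁻¹ • ((i k).1 + (i k).2 • v k - (i k).1)) atTop (𝓝 w) := by
    refine hv.congr' ?_
    filter_upwards [hit.eventually self_mem_nhdsWithin] with k hk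
    rw [add_sub_cancel_left, inv_smul_smul₀ (ne_of_gt hk)]
  have hΦ := tendsto_smul_sub_of_hasFDerivAtFilter (c.hasStrictFDerivAt hxs)
    (hq.prodMk_nhds hix) hquot
  have hfst := (continuous_fst.tendsto _).comp hΦ
  have hsnd := (continuous_snd.tendsto _).comp hΦ
  have hfq := tendsto_smul_sub_of_hasFDerivAtFilter hf
    (((tendsto_fst_apply hxs).comp hq).prodMk (tendsto_map.comp hiG)) hfst
  refine tendsto_nhds_unique hsnd (hfq.congr' ?_)
  filter_upwards [hit.eventually self_mem_nhdsWithin, hiΩ.eventually self_mem_nhdsWithin,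
    hix.eventually (Φ.open_source.mem_nhds hxs), hq.eventually (Φ.open_source.mem_nhds hxs)]
    with k hk hkΩ hks hqs
  have h1 := (c.apply_mem_graph hkΩ hks).2
  have h2 := (c.apply_mem_graph ((mem_quotientSet hk).1 (hvC k)) hqs).2
  simp [h1, h2]

theorem subset_innerLimit_quotientSet (c : IsLipschitzChart Ω Φ U f K) (hx : x ∈ Ω)
    (hxs : x ∈ Φ.source) {A : E →L[ℝ] F} {G : Filter X} (hG : G ≤ 𝓝[Ω] x)
    (hf : HasFDerivAtFilter f A (𝓝 (Φ x).1 ×ˢ map (fun y => (Φ y).1) G)) :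
    (graphPreimage (fderiv ℝ Φ x) A : Set X) ⊆
      innerLimit (G ×ˢ 𝓝[>] (0 : ℝ)) (fun p => quotientSet Ω p.1 p.2) := by
  intro w hw i hi
  have hiG : Tendsto (fun k => (i k).1) atTop G := tendsto_fst.comp hi
  have hiΩ := hiG.mono_right hG
  have hix := tendsto_nhds_of_tendsto_nhdsWithin hiΩ
  have hit : Tendsto (fun k => (i k).2) atTop (𝓝[>] 0) := tendsto_snd.comp hi
  obtain ⟨hxU, hxf⟩ := c.apply_mem_graph hx hxs
  set a := (fderiv ℝ Φ x w).1 with ha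
  set u : ℕ → E := fun k => (Φ (i k).1).1
  -- The recovery sequence moves the first chart coordinate by `t • a`, lifts to the graph of `f`
  -- and returns through `Φ.symm`.
  set u' : ℕ → E := fun k => u k + (i k).2 • a
  have hu : Tendsto u atTop (𝓝 (Φ x).1) := (tendsto_fst_apply hxs).comp hix
  have hu' : Tendsto u' atTop (𝓝 (Φ x).1) := by
    simpa using hu.add ((tendsto_nhds_of_tendsto_nhdsWithin hit).smul_const a)
  have hquot : Tendsto (fun k => (i k).2⁻¹ • (u' k - u k)) atTop (𝓝 a) := by
    refine tendsto_const_nhds.congr' ?_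
    filter_upwards [hit.eventually self_mem_nhdsWithin] with k hk
    rw [add_sub_cancel_left, inv_smul_smul₀ (ne_of_gt hk)]
  have hfq := tendsto_smul_sub_of_hasFDerivAtFilter hf
    (hu'.prodMk (tendsto_map.comp hiG)) hquot
  have hfc : ContinuousAt f (Φ x).1 :=
    c.lipschitzOnWith.continuousOn.continuousAt (c.isOpen.mem_nhds hxU)
  have hgraph : ∀ {z : ℕ → E}, Tendsto z atTop (𝓝 (Φ x).1) →
      Tendsto (fun k => (z k, f (z k))) atTop (𝓝 (Φ x)) := fun {z} hz => by
    have := hz.prodMk_nhds (hfc.tendsto.comp hz)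
    rwa [← hxf] at this
  have hpq : Tendsto (fun k => (i k).2⁻¹ • ((u' k, f (u' k)) - (u k, f (u k)))) atTop
      (𝓝 (fderiv ℝ Φ x w)) := by
    have := hquot.prodMk_nhds hfq
    rwa [ha, ← mem_graphPreimage.1 hw] at this
  have hfin := tendsto_smul_sub_of_hasFDerivAtFilter
    (c.hasStrictFDerivAt_symm (Φ.map_source hxs)) ((hgraph hu').prodMk_nhds (hgraph hu)) hpq
  rw [c.fderiv_symm_fderiv hxs] at hfin
  refine ⟨_, hfin, ?_⟩
  filter_upwards [hiΩ.eventually self_mem_nhdsWithin,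
    hix.eventually (Φ.open_source.mem_nhds hxs), hu'.eventually (c.isOpen.mem_nhds hxU)]
    with k hkΩ hks hk'
  have hk : Φ.symm (u k, f (u k)) = (i k).1 := by
    rw [← (c.apply_mem_graph hkΩ hks).2]
    exact Φ.left_inv hks
  exact ⟨_, c.symm_apply_mem hk', by rw [hk]⟩

theorem strictlySmoothSetAt (c : IsLipschitzChart Ω Φ U f K) (hx : x ∈ Ω) (hxs : x ∈ Φ.source)
    {A : E →L[ℝ] F} (hf : HasStrictFDerivAt f A (Φ x).1) : StrictlySmoothSetAt Ω x := by
  have hne : (𝓝[Ω] x).NeBot := mem_closure_iff_nhdsWithin_neBot.1 (subset_closure hx)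
  have hf' : HasFDerivAtFilter f A (𝓝 (Φ x).1 ×ˢ map (fun y => (Φ y).1) (𝓝[Ω] x)) := by
    refine HasFDerivAtFilter.mono hf ?_
    rw [nhds_prod_eq]
    exact prod_mono_right _ ((tendsto_fst_apply hxs).mono_left nhdsWithin_le_nhds)
  exact innerLimit_subset_outerLimit.antisymm
    ((c.outerLimit_quotientSet_subset hxs le_rfl hf').trans
      (c.subset_innerLimit_quotientSet hx hxs le_rfl hf'))

theorem cones_eq_graphPreimage (c : IsLipschitzChart Ω Φ U f K) (hx : x ∈ Ω)
    (hxs : x ∈ Φ.source) (hf : DifferentiableAt ℝ f (Φ x).1) :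
    derivableCone Ω x = graphPreimage (fderiv ℝ Φ x) (fderiv ℝ f (Φ x).1) ∧
      tangentCone Ω x = graphPreimage (fderiv ℝ Φ x) (fderiv ℝ f (Φ x).1) := by
  have hG : pure x ≤ 𝓝[Ω] x := pure_le_nhdsWithin hx
  have hf' : HasFDerivAtFilter f (fderiv ℝ f (Φ x).1)
      (𝓝 (Φ x).1 ×ˢ map (fun y => (Φ y).1) (pure x)) := by
    rw [map_pure]
    exact hf.hasFDerivAt
  have hout := c.outerLimit_quotientSet_subset hxs hG hf'
  have hin := c.subset_innerLimit_quotientSet hx hxs hG hf'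
  have hio := innerLimit_subset_outerLimit (l := pure x ×ˢ 𝓝[>] (0 : ℝ))
    (C := fun p => quotientSet Ω p.1 p.2)
  rw [derivableCone_eq_innerLimit_pure, tangentCone_eq_outerLimit_pure]
  exact ⟨(hio.trans hout).antisymm hin, hout.antisymm (hin.trans hio)⟩

theorem smoothSetAt (c : IsLipschitzChart Ω Φ U f K) (hx : x ∈ Ω) (hxs : x ∈ Φ.source)
    (hf : DifferentiableAt ℝ f (Φ x).1) : SmoothSetAt Ω x := by
  obtain ⟨h1, h2⟩ := c.cones_eq_graphPreimage hx hxs hf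
  exact ⟨h1.trans h2.symm, _, h2⟩

/-- Transfers the density of differentiability points of `f` to smooth points of `Ω`, and turns
sequences of the former into test sequences for the cones. -/
theorem tendsto_symm_graph (c : IsLipschitzChart Ω Φ U f K) (hx : x ∈ Ω) (hxs : x ∈ Φ.source) :
    Tendsto (fun u => Φ.symm (u, f u)) (𝓝[{u | u ∈ U ∧ DifferentiableAt ℝ f u}] (Φ x).1)
      (𝓝[{y | y ∈ Ω ∧ SmoothSetAt Ω y}] x) := by
  obtain ⟨hxU, hxf⟩ := c.apply_mem_graph hx hxs
  refine tendsto_nhdsWithin_iff.2 ⟨?_, ?_⟩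
  · have hfc : ContinuousAt f (Φ x).1 :=
      c.lipschitzOnWith.continuousOn.continuousAt (c.isOpen.mem_nhds hxU)
    have h1 : Tendsto (fun u => (u, f u)) (𝓝 (Φ x).1) (𝓝 (Φ x)) := by
      have := tendsto_id.prodMk_nhds hfc.tendsto
      rwa [← hxf] at this
    have h2 := (Φ.tendsto_symm hxs).comp h1
    exact h2.mono_left nhdsWithin_le_nhds
  · filter_upwards [self_mem_nhdsWithin] with u hu
    have ht := c.mem_target u hu.1
    have hΩ := c.symm_apply_mem hu.1
    refine ⟨hΩ, c.smoothSetAt hΩ (Φ.map_target ht) ?_⟩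
    rw [Φ.right_inv ht]
    exact hu.2

/-- If tangent cones at smooth points converge to `L`, every limit of derivatives of `f` has `L`
as the preimage of its graph. -/
theorem eq_graphPreimage_of_tendsto (c : IsLipschitzChart Ω Φ U f K) (hx : x ∈ Ω)
    (hxs : x ∈ Φ.source) {L : Set X}
    (hL : SetTendsto (𝓝[{y | y ∈ Ω ∧ SmoothSetAt Ω y}] x) (tangentCone Ω) L) {B : E →L[ℝ] F}
    {u : ℕ → E} (hu : Tendsto u atTop (𝓝[{u | u ∈ U ∧ DifferentiableAt ℝ f u}] (Φ x).1))
    (hB : Tendsto (fun k => fderiv ℝ f (u k)) atTop (𝓝 B)) :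
    L = graphPreimage (fderiv ℝ Φ x) B := by
  have hi := (c.tendsto_symm_graph hx hxs).comp hu
  set i : ℕ → X := (fun u => Φ.symm (u, f u)) ∘ u
  have hix : Tendsto i atTop (𝓝 x) := tendsto_nhds_of_tendsto_nhdsWithin hi
  have hcone : ∀ᶠ k in atTop,
      tangentCone Ω (i k) = graphPreimage (fderiv ℝ Φ (i k)) (fderiv ℝ f (u k)) := by
    filter_upwards [hu.eventually self_mem_nhdsWithin] with k hk
    have ht := c.mem_target _ hk.1
    have := (c.cones_eq_graphPreimage (c.symm_apply_mem hk.1) (Φ.map_target ht)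
      (by rw [Φ.right_inv ht]; exact hk.2)).2
    rwa [Φ.right_inv ht] at this
  have hdΦ : Tendsto (fun k => fderiv ℝ Φ (i k)) atTop (𝓝 (fderiv ℝ Φ x)) :=
    ((c.contDiffOn.continuousOn_fderiv_of_isOpen Φ.open_source le_rfl).continuousAt
      (Φ.open_source.mem_nhds hxs)).tendsto.comp hix
  have hdΨ : Tendsto (fun k => fderiv ℝ Φ.symm (Φ (i k))) atTop (𝓝 (fderiv ℝ Φ.symm (Φ x))) :=
    ((c.contDiffOn_symm.continuousOn_fderiv_of_isOpen Φ.open_target le_rfl).continuousAt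
      (Φ.open_target.mem_nhds (Φ.map_source hxs))).tendsto.comp
        ((Φ.continuousAt hxs).tendsto.comp hix)
  -- One inclusion uses `L` as inner limit, since every sequence of base points must then be
  -- followed; the other uses `L` as outer limit, since this one sequence is enough.
  apply Subset.antisymm
  · intro w hw
    rw [← hL.1] at hw
    obtain ⟨v, hv, hvC⟩ := hw i hi
    have hlim := tendsto_clm_apply hdΦ hv
    have hfst := (continuous_fst.tendsto _).comp hlim
    have hsnd := (continuous_snd.tendsto _).comp hlim
    refine tendsto_nhds_unique hsnd ((tendsto_clm_apply hB hfst).congr' ?_)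
    filter_upwards [hvC, hcone] with k hk hkc
    rw [hkc] at hk
    exact (mem_graphPreimage.1 hk).symm
  · intro w hw
    have ha : Tendsto (fun k => ((fderiv ℝ Φ x w).1, fderiv ℝ f (u k) (fderiv ℝ Φ x w).1)) atTop
        (𝓝 (fderiv ℝ Φ x w)) := by
      have := (tendsto_const_nhds (x := (fderiv ℝ Φ x w).1) (f := atTop (α := ℕ))).prodMk_nhds
        (tendsto_clm_apply hB (tendsto_const_nhds (x := (fderiv ℝ Φ x w).1)))
      rwa [← mem_graphPreimage.1 hw] at this
    have hlim := tendsto_clm_apply hdΨ ha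
    rw [c.fderiv_symm_fderiv hxs] at hlim
    rw [← hL.2]
    refine mem_outerLimit_of_eventually hi hlim ?_
    filter_upwards [hcone, hix.eventually (Φ.open_source.mem_nhds hxs)] with k hk hks
    rw [hk]
    refine mem_graphPreimage.2 ?_
    rw [c.fderiv_fderiv_symm hks]

variable [FiniteDimensional ℝ E] [FiniteDimensional ℝ F]

theorem neBot_nhdsWithin_smoothSetAt (c : IsLipschitzChart Ω Φ U f K) (hx : x ∈ Ω)
    (hxs : x ∈ Φ.source) : (𝓝[{y | y ∈ Ω ∧ SmoothSetAt Ω y}] x).NeBot := by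
  have := neBot_nhdsWithin_differentiableAt c.isOpen c.lipschitzOnWith
    (c.apply_mem_graph hx hxs).1
  exact (c.tendsto_symm_graph hx hxs).neBot

/-- Convergence of the tangent cones at smooth points forces strict smoothness. -/
theorem strictlySmoothSetAt_of_setTendsto (c : IsLipschitzChart Ω Φ U f K) (hx : x ∈ Ω)
    (hxs : x ∈ Φ.source) {L : Set X}
    (hL : SetTendsto (𝓝[{y | y ∈ Ω ∧ SmoothSetAt Ω y}] x) (tangentCone Ω) L) :
    StrictlySmoothSetAt Ω x := by
  have hxU := (c.apply_mem_graph hx hxs).1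
  set D : Set E := {u | u ∈ U ∧ DifferentiableAt ℝ f u}
  have hne : (𝓝[D] (Φ x).1).NeBot := neBot_nhdsWithin_differentiableAt c.isOpen
    c.lipschitzOnWith hxU
  have := FiniteDimensional.proper ℝ (E →L[ℝ] F)
  have hcomp := isCompact_closedBall (0 : E →L[ℝ] F) K
  have hbd : ∀ᶠ u in 𝓝[D] (Φ x).1, fderiv ℝ f u ∈ Metric.closedBall (0 : E →L[ℝ] F) K := by
    filter_upwards [self_mem_nhdsWithin] with u hu
    rw [mem_closedBall_zero_iff]
    exact norm_fderiv_le_of_lipschitzOn ℝ (c.isOpen.mem_nhds hu.1) c.lipschitzOnWith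
  have hcluster : ∀ B, MapClusterPt B (𝓝[D] (Φ x).1) (fderiv ℝ f) →
      L = graphPreimage (fderiv ℝ Φ x) B := fun B hB => by
    -- A sequence tending along this filter approaches the base point while its derivatives tend to
    -- `B`.
    have hne' : (𝓝[D] (Φ x).1 ⊓ comap (fderiv ℝ f) (𝓝 B)).NeBot := by
      rw [inf_comm, ← map_neBot_iff (fderiv ℝ f), Filter.push_pull']
      exact hB
    obtain ⟨u, hu⟩ := exists_seq_tendsto (𝓝[D] (Φ x).1 ⊓ comap (fderiv ℝ f) (𝓝 B))
    rw [tendsto_inf, tendsto_comap_iff] at hu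
    exact c.eq_graphPreimage_of_tendsto hx hxs hL hu.1 hu.2
  obtain ⟨A, -, hA⟩ := hcomp.exists_mapClusterPt_of_frequently hbd.frequently
  refine c.strictlySmoothSetAt hx hxs (A := A)
    (hasStrictFDerivAt_of_tendsto_fderiv c.isOpen c.lipschitzOnWith hxU ?_)
  -- In a compact ball, uniqueness of the cluster point is convergence; both `A` and `B` have `L` as
  -- preimage of their graph.
  refine hcomp.tendsto_nhds_of_unique_mapClusterPt hbd fun B _ hB => ?_
  refine graphPreimage_injective (T := fderiv ℝ Φ x)
    (fun y => ⟨_, c.fderiv_fderiv_symm hxs y⟩) (SetLike.coe_injective ?_)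
  exact (hcluster B hB).symm.trans (hcluster A hA)

end IsLipschitzChart

end Charts

end VarGeom

/-! ### The theorem, with the equivalences closed in a cycle. -/

theorem theorem2p3 {X : Type*} [NormedAddCommGroup X] [InnerProductSpace ℝ X]
    [FiniteDimensional ℝ X] (Ω : Set X) (xbar : X) (hx : xbar ∈ Ω)
    (hΩ : VarGeom.LocallyClosedAround Ω xbar) :
    -- (a) implies (b)
    (VarGeom.StrictlySmoothSetAt Ω xbar →
      VarGeom.SetTendsto (𝓝[Ω] xbar) (VarGeom.tangentCone Ω) (VarGeom.tangentCone Ω xbar)) ∧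
    -- on a Lipschitzian manifold (a) - (e) are equivalent
    (VarGeom.LipschitzManifoldAround Ω xbar →
      List.TFAE [
        VarGeom.StrictlySmoothSetAt Ω xbar,
        VarGeom.SetTendsto (𝓝[Ω] xbar) (VarGeom.tangentCone Ω) (VarGeom.tangentCone Ω xbar),
        VarGeom.SetTendsto (𝓝[{x | x ∈ Ω ∧ VarGeom.DerivableAt Ω x}] xbar)
          (VarGeom.tangentCone Ω) (VarGeom.tangentCone Ω xbar),
        VarGeom.SetTendsto (𝓝[{x | x ∈ Ω ∧ VarGeom.SmoothSetAt Ω x}] xbar)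
          (VarGeom.tangentCone Ω) (VarGeom.tangentCone Ω xbar),
        ∃ L : Set X, VarGeom.SetTendsto (𝓝[{x | x ∈ Ω ∧ VarGeom.SmoothSetAt Ω x}] xbar)
          (VarGeom.tangentCone Ω) L]) := by
  refine ⟨fun h => h.setTendsto_tangentCone hx, ?_⟩
  rintro ⟨Y, Z, -, Φ, U', U'', f, K, hxs, hΦ, hΦs, hU', -, htarget, hmaps, hlip, himage⟩
  have c : VarGeom.IsLipschitzChart Ω Φ U' f K :=
    ⟨hΦ, hΦs, hU', fun u hu => htarget ▸ ⟨hu, hmaps hu⟩, hlip, himage⟩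
  have hsd : 𝓝[{x | x ∈ Ω ∧ VarGeom.SmoothSetAt Ω x}] xbar ≤
      𝓝[{x | x ∈ Ω ∧ VarGeom.DerivableAt Ω x}] xbar :=
    nhdsWithin_mono _ fun x hx => ⟨hx.1, hx.2.1⟩
  have hdΩ : 𝓝[{x | x ∈ Ω ∧ VarGeom.DerivableAt Ω x}] xbar ≤ 𝓝[Ω] xbar :=
    nhdsWithin_mono _ fun x hx => hx.1
  have hs := c.neBot_nhdsWithin_smoothSetAt hx hxs
  have hd : (𝓝[{x | x ∈ Ω ∧ VarGeom.DerivableAt Ω x}] xbar).NeBot := hs.mono hsd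
  tfae_have 1 → 2 := fun h => h.setTendsto_tangentCone hx
  tfae_have 2 → 3 := fun h => h.mono hdΩ
  tfae_have 3 → 4 := fun h => h.mono hsd
  tfae_have 4 → 5 := fun h => ⟨_, h⟩
  tfae_have 5 → 1 := fun ⟨L, hL⟩ => c.strictlySmoothSetAt_of_setTendsto hx hxs hL
  tfae_finish
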